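/- A convex body is a compact convex subset of $\mathbb{R}^2$ with nonempty interior, and lengths are measured in the standard Euclidean norm $|\cdot|$. For a convex body $K\subset\mathbb{R}^2$ let $$\xi_B(K)=\inf\Big\{\sum_{i=1}^m |q_{i+1}-q_i| \;:\; m\ge 2,\ q_1,\dots,q_m\in\mathbb{R}^2,\ \{q_1,\dots,q_m\}\not\subseteq \operatorname{int}K+t \text{ for all } t\in\mathbb{R}^2\Big\},\qquad q_{m+1}=q_1,$$ the length of the shortest closed polygonal line that cannot be translated into the interior of $K$ (that is, of the shortest closed billiard trajectory in $K$, in the sense that is used for arbitrary, not necessarily smooth, bodies). Let $K-K=\{x-y : x,y\in K\}$. Then for every convex body $K\subset\mathbb{R}^2$ $$\xi_B(K-K)\le \frac{4}{\sqrt3}\,\xi_B(K).$$ The estimate is sharp: if a real number $c$ satisfies $\xi_B(K-K)\le c\,\xi_B(K)$ for every convex body $K\subset\mathbb{R}^2$, then $c\ge 4/\sqrt3$; moreover, $\xi_B(K-K)=\frac{4}{\sqrt3}\,\xi_B(K)$ for every (nondegenerate) equilateral triangle $K$. -/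

import Mathlib

open scoped Pointwise

/-- The Euclidean plane. -/
abbrev Plane : Type := EuclideanSpace ℝ (Fin 2)

section Billiards

variable {E : Type*} [NormedAddCommGroup E]

/-- Length of the closed polygonal line `q₁ → q₂ → ⋯ → q_m → q₁`
(`finRotate m` is the cyclic successor on `Fin m`). -/
def closedLength {m : ℕ} (q : Fin m → E) : ℝ :=
  ∑ i : Fin m, ‖q (finRotate m i) - q i‖

/-- `{q₁, …, q_m}` fits into `int K + t` for some translation vector `t`. -/
def FitsInterior (K : Set E) {m : ℕ} (q : Fin m → E) : Prop :=
  ∃ t : E, Set.range q ⊆ t +ᵥ interior K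

/-- The lengths of all closed polygonal lines with `m ≥ 2` vertices that cannot be translated
into the interior of `K`. -/
def nonFittingLengths (K : Set E) : Set ℝ :=
  {l : ℝ | ∃ (m : ℕ) (q : Fin m → E), 2 ≤ m ∧ ¬ FitsInterior K q ∧ closedLength q = l}

/-- The length of the shortest closed billiard trajectory in `K`, for an arbitrary (not necessarily
smooth) convex body `K`: the minimal length of a closed polygonal line that cannot be translated
into the interior of `K`. -/
noncomputable def xi (K : Set E) : ℝ :=
  sInf (nonFittingLengths K)

theorem nonFittingLengths_bddBelow (K : Set E) : BddBelow (nonFittingLengths K) := by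
  refine ⟨0, ?_⟩
  rintro l ⟨m, q, -, -, rfl⟩
  exact Finset.sum_nonneg fun i _ => norm_nonneg _

/-- For a bounded `K` (in a nonzero space) the infimum is taken over a nonempty set. -/
theorem nonFittingLengths_nonempty [NormedSpace ℝ E] [Nontrivial E] {K : Set E}
    (hK : Bornology.IsBounded K) : (nonFittingLengths K).Nonempty := by
  obtain ⟨C, hC⟩ := Metric.isBounded_iff.1 hK
  obtain ⟨x, hx⟩ := NormedSpace.exists_lt_norm ℝ E C
  refine ⟨_, 2, ![0, x], le_rfl, ?_, rfl⟩
  rintro ⟨t, ht⟩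
  obtain ⟨a, ha, ha'⟩ := ht ⟨0, rfl⟩
  obtain ⟨b, hb, hb'⟩ := ht ⟨1, rfl⟩
  have h := hC (interior_subset hb) (interior_subset ha)
  have e : b - a = x := by
    simp only [vadd_eq_add, Matrix.cons_val_zero, Matrix.cons_val_one] at ha' hb'
    rw [← hb', ← sub_zero (t + b), ← ha']
    abel
  rw [dist_eq_norm, e] at h
  exact absurd h (not_le.2 hx)

end Billiards

/-!
A closed polygon that does not fit into `int K` contains, by Helly's theorem, three vertices that
do not fit either, and passing to them does not increase its length `L`. Separating the translates
of this triangle `q` from `(int K)³` gives vectors `u₀, u₁, u₂` with sum zero such that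
`∑ ⟪uᵢ, xᵢ⟫ ≤ ∑ ⟪uᵢ, qᵢ⟫` for all `xᵢ ∈ K`. Summation by parts writes the right hand side as the
sum of the inner products of the sides of `q` with three points whose distances are the `‖uᵢ‖`; by
Jung's theorem it is at most `L / √3 * maxᵢ ‖uᵢ‖`. Hence `K` has width at most `L / √3` in the
direction of the longest `uᵢ`, so `K - K` has width at most `2L / √3` in that direction, and a ball
bouncing back and forth across `K - K` travels at most `4L / √3`.

For an equilateral triangle of side `a`, the medial triangle does not fit into the interior and
has length `3a / 2`, whereas `K - K` contains a ball of radius `√3 / 2 * a`. A closed curve of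
length `L` lies in a ball of radius `L / 4`, so a curve that does not fit into `K - K` is at least
`2 √3 a` long.
-/

section PolygonalPaths

variable {X : Type*} [PseudoMetricSpace X]

/-- The length of the polygonal path `p 0 → p 1 → ⋯ → p n`. As a function of `n` it serves as an arc
length parameter at the vertices. -/
def pathLength (p : ℕ → X) (n : ℕ) : ℝ :=
  ∑ i ∈ Finset.range n, dist (p i) (p (i + 1))

theorem dist_le_pathLength_sub (p : ℕ → X) {i j : ℕ} (hij : i ≤ j) :
    dist (p i) (p j) ≤ pathLength p j - pathLength p i :=
  (dist_le_Ico_sum_dist p hij).trans_eq (Finset.sum_Ico_eq_sub _ hij)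

theorem dist_zero_le_pathLength (p : ℕ → X) (i : ℕ) : dist (p 0) (p i) ≤ pathLength p i :=
  dist_le_range_sum_dist p i

theorem exists_forall_dist_le_abs_pathLength_sub {E : Type*} [NormedAddCommGroup E]
    [NormedSpace ℝ E] (p : ℕ → E) {n : ℕ} {s : ℝ} (hs₀ : 0 ≤ s) (hs : s ≤ pathLength p n) :
    ∃ b, ∀ i, dist (p i) b ≤ |pathLength p i - s| := by
  induction n with
  | zero =>
    obtain rfl : s = 0 := le_antisymm hs hs₀
    refine ⟨p 0, fun i => ?_⟩
    rw [dist_comm, sub_zero]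
    exact (dist_zero_le_pathLength p i).trans (le_abs_self _)
  | succ n ih =>
    rcases le_or_gt s (pathLength p n) with hle | hlt
    · exact ih hle
    have hstep : pathLength p (n + 1) = pathLength p n + dist (p n) (p (n + 1)) :=
      Finset.sum_range_succ _ _
    obtain ⟨b, hb, hb'⟩ := exists_dist_le_le (x := p n) (z := p (n + 1))
      (sub_nonneg.2 hlt.le) (sub_nonneg.2 hs) (by linarith)
    refine ⟨b, fun i => ?_⟩
    rcases Nat.lt_or_ge n i with hi | hi
    · calc dist (p i) b ≤ dist (p (n + 1)) (p i) + dist b (p (n + 1)) := by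
            rw [dist_comm b]
            exact dist_triangle_left _ _ _
        _ ≤ (pathLength p i - pathLength p (n + 1)) + (pathLength p (n + 1) - s) :=
            add_le_add (dist_le_pathLength_sub p hi) hb'
        _ = pathLength p i - s := by ring
        _ ≤ |pathLength p i - s| := le_abs_self _
    · calc dist (p i) b ≤ dist (p i) (p n) + dist (p n) b := dist_triangle _ _ _
        _ ≤ (pathLength p n - pathLength p i) + (s - pathLength p n) :=
            add_le_add (dist_le_pathLength_sub p hi) hb
        _ = -(pathLength p i - s) := by ring
        _ ≤ |pathLength p i - s| := neg_le_abs _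

end PolygonalPaths

section PeriodicPaths

variable {X : Type*} {m : ℕ} [NeZero m]

/-- The closed polygonal line `q` run through repeatedly, as an `m`-periodic path. It
turns closed lines into paths, whose partial lengths make sense. -/
def periodicPath (q : Fin m → X) (l : ℕ) : X :=
  q (Fin.ofNat m l)

theorem periodicPath_val (q : Fin m → X) (i : Fin m) :
    periodicPath q i = q i := by
  simp [periodicPath]

theorem periodicPath_period (q : Fin m → X) :
    periodicPath q m = periodicPath q 0 := by
  simp [periodicPath, Fin.ofNat]

end PeriodicPaths

section ClosedPolygons

variable {E : Type*} [NormedAddCommGroup E]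

theorem closedLength_eq_pathLength {m : ℕ} [NeZero m] (q : Fin m → E) :
    closedLength q = pathLength (periodicPath q) m := by
  obtain ⟨n, rfl⟩ := Nat.exists_eq_succ_of_ne_zero (NeZero.ne m)
  rw [pathLength, Finset.sum_range, closedLength]
  refine Finset.sum_congr rfl fun l _ => ?_
  rw [dist_comm, dist_eq_norm, periodicPath_val, finRotate_apply]
  congr 3
  ext
  simp [Fin.val_add]

theorem dist_periodicPath_zero_le {m : ℕ} [NeZero m] (q : Fin m → E) (i : Fin m) :
    dist (q i) (periodicPath q 0) ≤ pathLength (periodicPath q) i ∧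
    dist (q i) (periodicPath q 0) ≤ closedLength q - pathLength (periodicPath q) i := by
  constructor
  · rw [dist_comm, ← periodicPath_val q i]
    exact dist_zero_le_pathLength _ _
  · rw [closedLength_eq_pathLength, ← periodicPath_period, ← periodicPath_val q i]
    exact dist_le_pathLength_sub (periodicPath q) i.isLt.le

theorem closedLength_succ {n : ℕ} (q : Fin (n + 1) → E) :
    closedLength q =
      ∑ i : Fin n, dist (q i.castSucc) (q i.succ) + dist (q (Fin.last n)) (q 0) := by
  simp only [closedLength, Fin.sum_univ_castSucc, finRotate_apply, Fin.coeSucc_eq_succ,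
    Fin.last_add_one, dist_eq_norm']

theorem closedLength_comp_le_of_monotone {m n : ℕ} (q : Fin m → E) {φ : Fin n → Fin m}
    (hφ : Monotone φ) : closedLength (q ∘ φ) ≤ closedLength q := by
  cases n with
  | zero => exact Finset.sum_nonneg fun _ _ => norm_nonneg _
  | succ k =>
    have : NeZero m := ⟨(φ 0).pos.ne'⟩
    let S : Fin (k + 1) → ℝ := fun i => pathLength (periodicPath q) (φ i)
    have hsides : ∑ i : Fin k, dist (q (φ i.castSucc)) (q (φ i.succ)) ≤ S (Fin.last k) - S 0 := by
      calc _ ≤ ∑ i : Fin k, (S i.succ - S i.castSucc) := Finset.sum_le_sum fun i _ => by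
            simpa only [periodicPath_val] using
              dist_le_pathLength_sub (periodicPath q) (hφ i.castSucc_le_succ)
        _ = S (Fin.last k) - S 0 := by
            rw [Finset.sum_sub_distrib]
            linarith [Fin.sum_univ_succ S, Fin.sum_univ_castSucc S]
    have hclose : dist (q (φ (Fin.last k))) (q (φ 0)) ≤ closedLength q - S (Fin.last k) + S 0 :=
      (dist_triangle_right _ _ (periodicPath q 0)).trans <|
        add_le_add (dist_periodicPath_zero_le q _).2 (dist_periodicPath_zero_le q _).1
    rw [closedLength_succ]
    simp only [Function.comp_apply]
    linarith

/-- The centre is the midpoint of two points that cut the closed line into halves of equal length: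
the distances from a vertex to these two points add up to at most half the length. -/
theorem exists_forall_dist_le_closedLength_div_four [NormedSpace ℝ E] {m : ℕ} (q : Fin m → E) :
    ∃ o, ∀ i, dist (q i) o ≤ closedLength q / 4 := by
  rcases Nat.eq_zero_or_pos m with rfl | hm
  · exact ⟨0, fun i => i.elim0⟩
  have : NeZero m := ⟨hm.ne'⟩
  have hL : 0 ≤ closedLength q := Finset.sum_nonneg fun _ _ => norm_nonneg _
  obtain ⟨b, hb⟩ := exists_forall_dist_le_abs_pathLength_sub (periodicPath q) (n := m)
    (s := closedLength q / 2) (by linarith) (by rw [← closedLength_eq_pathLength]; linarith)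
  refine ⟨midpoint ℝ (periodicPath q 0) b, fun i => ?_⟩
  obtain ⟨hfwd, hbwd⟩ := dist_periodicPath_zero_le q i
  have hsum : dist (q i) (periodicPath q 0) + dist (q i) b ≤ closedLength q / 2 := by
    have := periodicPath_val q i ▸ hb i
    rcases abs_cases (pathLength (periodicPath q) i - closedLength q / 2) with h | h <;> linarith
  have hmid : dist (q i) (midpoint ℝ (periodicPath q 0) b) ≤
      (dist (q i) (periodicPath q 0) + dist (q i) b) / 2 := by
    simpa using dist_midpoint_midpoint_le (q i) (q i) (periodicPath q 0) b
  linarith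

end ClosedPolygons

section Fitting

variable {E : Type*} [NormedAddCommGroup E] {K : Set E} {m : ℕ} {q : Fin m → E}

theorem fitsInterior_iff : FitsInterior K q ↔ ∃ t, ∀ i, q i - t ∈ interior K := by
  simp only [FitsInterior, Set.range_subset_iff, Set.mem_vadd_set_iff_neg_vadd_mem, vadd_eq_add,
    neg_add_eq_sub]

theorem xi_le_closedLength (hm : 2 ≤ m) (hq : ¬ FitsInterior K q) : xi K ≤ closedLength q :=
  csInf_le (nonFittingLengths_bddBelow K) ⟨m, q, hm, hq, rfl⟩

theorem le_xi (hK : (nonFittingLengths K).Nonempty) {l : ℝ}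
    (h : ∀ (m : ℕ) (q : Fin m → E), 2 ≤ m → ¬ FitsInterior K q → l ≤ closedLength q) :
    l ≤ xi K := by
  refine le_csInf hK ?_
  rintro _ ⟨m, q, hm, hq, rfl⟩
  exact h m q hm hq

theorem four_mul_le_xi_of_ball_subset [NormedSpace ℝ E] (hK : (nonFittingLengths K).Nonempty)
    {c : E} {r : ℝ} (hball : Metric.ball c r ⊆ K) : 4 * r ≤ xi K := by
  refine le_xi hK fun m q _ hq => ?_
  by_contra! hlt
  obtain ⟨o, ho⟩ := exists_forall_dist_le_closedLength_div_four q
  refine hq (fitsInterior_iff.2 ⟨o - c, fun i => interior_maximal hball Metric.isOpen_ball ?_⟩)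
  rw [Metric.mem_ball, dist_eq_norm, sub_sub, sub_add_cancel, ← dist_eq_norm]
  linarith [ho i]

theorem xi_pos [NormedSpace ℝ E] (hK : (nonFittingLengths K).Nonempty)
    (hint : (interior K).Nonempty) : 0 < xi K := by
  obtain ⟨c, hc⟩ := hint
  obtain ⟨r, hr, hball⟩ := Metric.mem_nhds_iff.1 (mem_interior_iff_mem_nhds.1 hc)
  exact (by positivity : 0 < 4 * r).trans_le (four_mul_le_xi_of_ball_subset hK hball)

theorem exists_monotone_fin_subset_range {α : Type*} [LinearOrder α] {I : Finset α}
    (hI : I.Nonempty) {n : ℕ} (hn : I.card ≤ n) :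
    ∃ φ : Fin n → α, Monotone φ ∧ ↑I ⊆ Set.range φ := by
  have hpos := hI.card_pos
  refine ⟨fun j => I.orderEmbOfFin rfl ⟨min j (I.card - 1), by omega⟩, fun j k hjk =>
    (I.orderEmbOfFin rfl).monotone (Fin.mk_le_mk.2 (min_le_min_right _ hjk)), fun x hx => ?_⟩
  obtain ⟨j, rfl⟩ := (I.range_orderEmbOfFin rfl).ge hx
  exact ⟨⟨j, by omega⟩, congrArg _ (Fin.ext (min_eq_left (Nat.le_sub_one_of_lt j.isLt)))⟩

theorem exists_monotone_not_fitsInterior_comp [NormedSpace ℝ E] [FiniteDimensional ℝ E]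
    {d : ℕ} (hd : Module.finrank ℝ E ≤ d) (hK : Convex ℝ K) (hq : ¬ FitsInterior K q) :
    ∃ φ : Fin (d + 1) → Fin m, Monotone φ ∧ ¬ FitsInterior K (q ∘ φ) := by
  by_contra! hfit
  have hconv (i : Fin m) : Convex ℝ {t | q i - t ∈ interior K} :=
    hK.interior.affine_preimage (AffineEquiv.constVSub ℝ (q i)).toAffineMap
  have hinter (I : Finset (Fin m)) (hI : I.card ≤ Module.finrank ℝ E + 1) :
      (⋂ i ∈ I, {t | q i - t ∈ interior K}).Nonempty := by
    rcases I.eq_empty_or_nonempty with rfl | hne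
    · simp
    obtain ⟨φ, hφ, hIφ⟩ := exists_monotone_fin_subset_range hne (hI.trans (Nat.succ_le_succ hd))
    obtain ⟨t, ht⟩ := fitsInterior_iff.1 (hfit φ hφ)
    refine ⟨t, Set.mem_iInter₂.2 fun i hi => ?_⟩
    obtain ⟨j, rfl⟩ := hIφ hi
    exact ht j
  obtain ⟨t, ht⟩ := Convex.helly_theorem' (s := Finset.univ) (fun i _ => hconv i)
    fun I _ => hinter I
  exact hq (fitsInterior_iff.2 ⟨t, fun i => Set.mem_iInter₂.1 ht i (Finset.mem_univ i)⟩)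

end Fitting

section Jung

variable {ι : Type*}

theorem sum_sum_mul_sub_ite_eq [DecidableEq ι] (s : Finset ι) (w : ι → ℝ) :
    ∑ i ∈ s, ∑ j ∈ s, (w i * w j - if i = j then w i ^ 2 else 0) =
      (∑ i ∈ s, w i) ^ 2 - ∑ i ∈ s, w i ^ 2 := by
  simp +contextual only [Finset.sum_sub_distrib, Finset.sum_ite_eq, if_true, sq,
    Finset.sum_mul_sum]

variable {E : Type*} [NormedAddCommGroup E]

theorem sum_sum_mul_norm_sub_sq_le [Fintype ι] {w : ι → ℝ} (hw : ∀ i, 0 ≤ w i) {v : ι → E}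
    {r : ℝ} (hv : ∀ i j, ‖v i - v j‖ ≤ r) :
    ∑ i, ∑ j, w i * w j * ‖v i - v j‖ ^ 2 ≤
      (1 - (Fintype.card ι : ℝ)⁻¹) * (r * ∑ i, w i) ^ 2 := by
  classical
  have hterm (i j : ι) :
      w i * w j * ‖v i - v j‖ ^ 2 ≤ (w i * w j - if i = j then w i ^ 2 else 0) * r ^ 2 := by
    split_ifs with h
    · subst h
      simp [sq]
    · rw [sub_zero]
      exact mul_le_mul_of_nonneg_left (pow_le_pow_left₀ (norm_nonneg _) (hv i j) 2)
        (mul_nonneg (hw i) (hw j))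
  calc ∑ i, ∑ j, w i * w j * ‖v i - v j‖ ^ 2
      ≤ ∑ i, ∑ j, (w i * w j - if i = j then w i ^ 2 else 0) * r ^ 2 :=
        Finset.sum_le_sum fun i _ => Finset.sum_le_sum fun j _ => hterm i j
    _ = ((∑ i, w i) ^ 2 - ∑ i, w i ^ 2) * r ^ 2 := by
        simp only [← Finset.sum_mul, sum_sum_mul_sub_ite_eq]
    _ ≤ ((∑ i, w i) ^ 2 - (Fintype.card ι : ℝ)⁻¹ * (∑ i, w i) ^ 2) * r ^ 2 := by
        gcongr
        rcases isEmpty_or_nonempty ι with _ | _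
        · simp
        rw [inv_mul_le_iff₀ (by exact_mod_cast Fintype.card_pos)]
        exact sq_sum_le_card_mul_sum_sq
    _ = (1 - (Fintype.card ι : ℝ)⁻¹) * (r * ∑ i, w i) ^ 2 := by ring

variable [InnerProductSpace ℝ E]

open scoped RealInnerProductSpace

theorem norm_sum_smul_sq (s : Finset ι) (w : ι → ℝ) (v : ι → E) :
    ‖∑ i ∈ s, w i • v i‖ ^ 2 = (∑ i ∈ s, w i) * ∑ i ∈ s, w i * ‖v i‖ ^ 2 -
      (∑ i ∈ s, ∑ j ∈ s, w i * w j * ‖v i - v j‖ ^ 2) / 2 := by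
  have hexpand : ‖∑ i ∈ s, w i • v i‖ ^ 2 = ∑ i ∈ s, ∑ j ∈ s, w i * w j * ⟪v i, v j⟫ := by
    rw [← real_inner_self_eq_norm_sq, sum_inner]
    simp only [inner_sum, real_inner_smul_left, real_inner_smul_right, mul_left_comm, mul_assoc]
  have hleft : (∑ i ∈ s, w i) * ∑ i ∈ s, w i * ‖v i‖ ^ 2 =
      ∑ i ∈ s, ∑ j ∈ s, w i * w j * ‖v j‖ ^ 2 := by
    simp only [Finset.sum_mul_sum, mul_assoc]
  have hright : (∑ i ∈ s, w i) * ∑ i ∈ s, w i * ‖v i‖ ^ 2 =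
      ∑ i ∈ s, ∑ j ∈ s, w i * w j * ‖v i‖ ^ 2 := by
    rw [hleft, Finset.sum_comm]
    simp only [mul_comm]
  have hdist : ∑ i ∈ s, ∑ j ∈ s, w i * w j * ‖v i - v j‖ ^ 2 =
      ∑ i ∈ s, ∑ j ∈ s, w i * w j * ‖v i‖ ^ 2 - 2 * ∑ i ∈ s, ∑ j ∈ s, w i * w j * ⟪v i, v j⟫ +
        ∑ i ∈ s, ∑ j ∈ s, w i * w j * ‖v j‖ ^ 2 := by
    simp only [norm_sub_sq_real, mul_add, mul_sub, Finset.sum_add_distrib, Finset.sum_sub_distrib,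
      Finset.mul_sum]
    ring_nf
  rw [hexpand, hdist, ← hleft, ← hright]
  ring

variable [Fintype ι]

/-- The constant is the one of Jung's theorem: a set of `n` points of diameter `r` lies in a ball
of radius `r * √((1 - n⁻¹) / 2)`. Taking a weighted barycentre as the centre makes it unnecessary
to find that ball. -/
theorem sum_mul_norm_sub_barycenter_le {w : ι → ℝ} (hw : ∀ i, 0 ≤ w i) {v : ι → E} {r : ℝ}
    (hr : 0 ≤ r) (hv : ∀ i j, ‖v i - v j‖ ≤ r) {o : E} (ho : ∑ i, w i • (v i - o) = 0) :
    ∑ i, w i * ‖v i - o‖ ≤ r * √((1 - (Fintype.card ι : ℝ)⁻¹) / 2) * ∑ i, w i := by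
  have hsum : 0 ≤ ∑ i, w i := Finset.sum_nonneg fun i _ => hw i
  have hvar : (∑ i, w i) * ∑ i, w i * ‖v i - o‖ ^ 2 =
      (∑ i, ∑ j, w i * w j * ‖v i - v j‖ ^ 2) / 2 := by
    have := norm_sum_smul_sq Finset.univ w fun i => v i - o
    simp only [ho, norm_zero, sub_sub_sub_cancel_right] at this
    linarith
  have hcs : (∑ i, w i * ‖v i - o‖) ^ 2 ≤ (∑ i, w i) * ∑ i, w i * ‖v i - o‖ ^ 2 :=
    Finset.sum_sq_le_sum_mul_sum_of_sq_le_mul _ (fun i _ => hw i)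
      (fun i _ => mul_nonneg (hw i) (sq_nonneg _)) fun i _ => le_of_eq (by ring)
  have hsq : (∑ i, w i * ‖v i - o‖) ^ 2 ≤
      (1 - (Fintype.card ι : ℝ)⁻¹) / 2 * (r * ∑ i, w i) ^ 2 := by
    linarith [sum_sum_mul_norm_sub_sq_le hw hv]
  calc ∑ i, w i * ‖v i - o‖ ≤ √((1 - (Fintype.card ι : ℝ)⁻¹) / 2 * (r * ∑ i, w i) ^ 2) :=
        Real.le_sqrt_of_sq_le hsq
    _ = r * √((1 - (Fintype.card ι : ℝ)⁻¹) / 2) * ∑ i, w i := by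
        rw [Real.sqrt_mul' _ (sq_nonneg _), Real.sqrt_sq (mul_nonneg hr hsum)]
        ring

theorem sum_inner_le_of_norm_sub_le {v d : ι → E} (hd : ∑ i, d i = 0) {r : ℝ} (hr : 0 ≤ r)
    (hv : ∀ i j, ‖v i - v j‖ ≤ r) :
    ∑ i, ⟪v i, d i⟫ ≤ r * √((1 - (Fintype.card ι : ℝ)⁻¹) / 2) * ∑ i, ‖d i‖ := by
  have hnonneg : 0 ≤ ∑ i, ‖d i‖ := Finset.sum_nonneg fun i _ => norm_nonneg _
  obtain ⟨o, ho⟩ : ∃ o, ∑ i, ‖d i‖ • (v i - o) = 0 := by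
    rcases hnonneg.eq_or_lt' with h | h
    · have hzero (i : ι) : ‖d i‖ = 0 :=
        (Finset.sum_eq_zero_iff_of_nonneg fun i _ => norm_nonneg _).1 h i (Finset.mem_univ i)
      exact ⟨0, by simp [hzero]⟩
    · refine ⟨(∑ i, ‖d i‖)⁻¹ • ∑ i, ‖d i‖ • v i, ?_⟩
      simp only [smul_sub, Finset.sum_sub_distrib, ← Finset.sum_smul]
      rw [smul_inv_smul₀ h.ne', sub_self]
  calc ∑ i, ⟪v i, d i⟫ = ∑ i, ⟪v i - o, d i⟫ := by
        simp only [inner_sub_left, Finset.sum_sub_distrib, ← inner_sum, hd, inner_zero_right,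
          sub_zero]
    _ ≤ ∑ i, ‖d i‖ * ‖v i - o‖ := by
        gcongr with i
        rw [mul_comm]
        exact real_inner_le_norm _ _
    _ ≤ _ := sum_mul_norm_sub_barycenter_le (fun i => norm_nonneg _) hr hv ho

/-- Summation by parts: the partial sums of `u` have pairwise differences `± u i`. -/
theorem sum_inner_le_mul_closedLength {u q : Fin 3 → E} (hu : ∑ i, u i = 0) {r : ℝ}
    (hr : ∀ i, ‖u i‖ ≤ r) : ∑ i, ⟪u i, q i⟫ ≤ r / √3 * closedLength q := by
  let v : Fin 3 → E := ![-u 0, u 2, 0]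
  have hr₀ : 0 ≤ r := (norm_nonneg _).trans (hr 0)
  have hu₁ : u 1 = -u 0 - u 2 := by
    rw [Fin.sum_univ_three] at hu
    rw [eq_sub_iff_add_eq, eq_neg_iff_add_eq_zero, ← hu]
    abel
  have hr₁ : ‖-u 0 - u 2‖ ≤ r := hu₁ ▸ hr 1
  have hr₁' : ‖u 2 + u 0‖ ≤ r := by rwa [← norm_neg, add_comm, neg_add']
  have hpartial (i j : Fin 3) : ‖v i - v j‖ ≤ r := by
    fin_cases i <;> fin_cases j <;> simp [v, hr₀, hr, hr₁, hr₁']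
  have hparts : ∑ i, ⟪u i, q i⟫ = ∑ i, ⟪v i, q (finRotate 3 i) - q i⟫ := by
    simp only [Fin.sum_univ_three, hu₁, v, Matrix.cons_val, finRotate_apply, inner_sub_left,
      inner_sub_right, inner_neg_left, inner_zero_left, Fin.reduceAdd]
    ring
  have hclosed : ∑ i, (q (finRotate 3 i) - q i) = 0 := by
    rw [Finset.sum_sub_distrib, Equiv.sum_comp, sub_self]
  have hjung : √((1 - (Fintype.card (Fin 3) : ℝ)⁻¹) / 2) = 1 / √3 := by
    rw [Fintype.card_fin, ← Real.sqrt_one, ← Real.sqrt_div zero_le_one, Real.sqrt_one]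
    norm_num
  calc ∑ i, ⟪u i, q i⟫ = ∑ i, ⟪v i, q (finRotate 3 i) - q i⟫ := hparts
    _ ≤ r * √((1 - (Fintype.card (Fin 3) : ℝ)⁻¹) / 2) * closedLength q :=
        sum_inner_le_of_norm_sub_le hclosed hr₀ hpartial
    _ = r / √3 * closedLength q := by rw [hjung, mul_one_div]

end Jung

section Normals

variable {E : Type*} [NormedAddCommGroup E] {K : Set E} {m : ℕ} {q : Fin m → E}

theorem linearMap_eq_zero_of_forall_le [NormedSpace ℝ E] {f : E →ₗ[ℝ] ℝ} {c : ℝ}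
    (h : ∀ x, f x ≤ c) : f = 0 := by
  by_contra hf
  obtain ⟨x, hx⟩ := LinearMap.surjective hf (c + 1)
  linarith [h x]

/-- The polygons inside `K` form the convex set `K ^ m` in `Fin m → E`, and `q` not fitting means
that the translates of `q` avoid its interior. A functional separating the two is bounded on one
side along the translates, hence constant there. -/
theorem exists_dual_le_of_not_fitsInterior [NormedSpace ℝ E] (hK : Convex ℝ K)
    (hint : (interior K).Nonempty) (hq : ¬ FitsInterior K q) :
    ∃ f : StrongDual ℝ (Fin m → E), f ≠ 0 ∧ (∀ t, f (fun _ => t) = 0) ∧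
      ∀ x : Fin m → E, (∀ i, x i ∈ K) → f x ≤ f q := by
  have hinterior : interior (Set.univ.pi fun _ : Fin m => K) = Set.univ.pi fun _ => interior K :=
    interior_pi_set Set.finite_univ
  have htranslates : Convex ℝ (Set.range fun t i => q i - t) := by
    rintro _ ⟨s, rfl⟩ _ ⟨t, rfl⟩ a b - - hab
    obtain rfl : b = 1 - a := eq_sub_of_add_eq' hab
    exact ⟨a • s + (1 - a) • t, funext fun i => by simp only [Pi.add_apply, Pi.smul_apply]; module⟩
  have hdisjoint : Disjoint (interior (Set.univ.pi fun _ : Fin m => K))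
      (Set.range fun t i => q i - t) := by
    rw [hinterior, Set.disjoint_right]
    rintro _ ⟨t, rfl⟩ ht
    exact hq (fitsInterior_iff.2 ⟨t, fun i => ht i trivial⟩)
  have hnonempty : (interior (Set.univ.pi fun _ : Fin m => K)).Nonempty := by
    rw [hinterior]
    exact Set.univ_pi_nonempty_iff.2 fun _ => hint
  obtain ⟨f, c, hf₀, hfK, hfq⟩ := geometric_hahn_banach_of_nonempty_interior
    (convex_pi fun _ _ => hK) htranslates hdisjoint hnonempty (Set.range_nonempty _)
  let g : E →ₗ[ℝ] ℝ := f.toLinearMap ∘ₗ LinearMap.pi fun _ => LinearMap.id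
  have hfqt (t : E) : c ≤ f q - g t :=
    (hfq _ ⟨t, rfl⟩).trans_eq (map_sub f q fun _ => t)
  have hg : g = 0 := linearMap_eq_zero_of_forall_le fun t => le_sub_comm.1 (hfqt t)
  refine ⟨f, hf₀, LinearMap.congr_fun hg, fun x hx => ?_⟩
  calc f x ≤ c := hfK x fun i _ => hx i
    _ ≤ f q - g 0 := hfqt 0
    _ = f q := by rw [map_zero, sub_zero]

variable [InnerProductSpace ℝ E]

open scoped RealInnerProductSpace

theorem exists_normals_of_not_fitsInterior [CompleteSpace E] (hK : Convex ℝ K)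
    (hint : (interior K).Nonempty) (hq : ¬ FitsInterior K q) :
    ∃ u : Fin m → E, u ≠ 0 ∧ ∑ i, u i = 0 ∧
      ∀ x : Fin m → E, (∀ i, x i ∈ K) → ∑ i, ⟪u i, x i⟫ ≤ ∑ i, ⟪u i, q i⟫ := by
  obtain ⟨f, hf₀, hfconst, hfK⟩ := exists_dual_le_of_not_fitsInterior hK hint hq
  let u (i : Fin m) : E :=
    (InnerProductSpace.toDual ℝ E).symm (f ∘L ContinuousLinearMap.single ℝ (fun _ => E) i)
  have hfu (x : Fin m → E) : ∑ i, ⟪u i, x i⟫ = f x := by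
    simp only [u, InnerProductSpace.toDual_symm_apply, ContinuousLinearMap.sum_comp_single]
  refine ⟨u, fun hu => hf₀ ?_, ext_inner_right ℝ fun t => ?_, fun x hx => ?_⟩
  · ext x
    simp [← hfu, hu]
  · rw [sum_inner, inner_zero_left]
    exact (hfu fun _ => t).trans (hfconst t)
  · rw [hfu, hfu]
    exact hfK x hx

end Normals

section Width

variable {E : Type*} [NormedAddCommGroup E] [InnerProductSpace ℝ E] {K : Set E} {n : E} {W : ℝ}

open scoped RealInnerProductSpace

/-- `K` has width at most `W` in the direction of `n`, that is, `K` lies between two hyperplanes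
orthogonal to `n` at distance `W`. The factor `‖n‖` spares normalizing `n`; the notion is meaningful
for `n ≠ 0` only. -/
def HasWidthLE (K : Set E) (n : E) (W : ℝ) : Prop :=
  ∀ x ∈ K, ∀ y ∈ K, ⟪n, x - y⟫ ≤ W * ‖n‖

theorem HasWidthLE.sub_self (h : HasWidthLE K n W) : HasWidthLE (K - K) n (2 * W) := by
  rintro _ ⟨x, hx, y, hy, rfl⟩ _ ⟨x', hx', y', hy', rfl⟩
  have hsplit : ⟪n, x - y - (x' - y')⟫ = ⟪n, x - x'⟫ + ⟪n, y' - y⟫ := by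
    rw [← inner_add_right]
    congr 1
    abel
  linarith [h x hx x' hx', h y' hy' y hy]

theorem HasWidthLE.inner_sub_lt_of_mem_interior (h : HasWidthLE K n W) (hn : n ≠ 0) {x y : E}
    (hx : x ∈ interior K) (hy : y ∈ K) : ⟪n, x - y⟫ < W * ‖n‖ := by
  have hn' : innerSL ℝ n ≠ 0 := fun h₀ => hn (inner_self_eq_zero.1 (DFunLike.congr_fun h₀ n))
  have hsub : K ⊆ innerSL ℝ n ⁻¹' Set.Iic (W * ‖n‖ + ⟪n, y⟫) := fun z hz => by
    have := h z hz y hy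
    rw [inner_sub_right] at this
    exact sub_le_iff_le_add.1 this
  have hxlt : x ∈ innerSL ℝ n ⁻¹' interior (Set.Iic (W * ‖n‖ + ⟪n, y⟫)) := by
    rw [(ContinuousLinearMap.isOpenMap_of_ne_zero _ hn').preimage_interior_eq_interior_preimage
      (innerSL ℝ n).continuous]
    exact interior_mono hsub hx
  rw [interior_Iic] at hxlt
  rw [inner_sub_right]
  exact sub_lt_iff_lt_add.2 hxlt

/-- A ball bouncing between the two supporting hyperplanes orthogonal to `n`. -/
theorem xi_le_two_mul_of_hasWidthLE (h : HasWidthLE K n W) (hn : n ≠ 0) (hW : 0 ≤ W) :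
    xi K ≤ 2 * W := by
  have hnorm : 0 < ‖n‖ := norm_pos_iff.2 hn
  let d : E := (W / ‖n‖) • n
  have hd : ‖d‖ = W := by
    rw [norm_smul, Real.norm_of_nonneg (by positivity), div_mul_cancel₀ _ hnorm.ne']
  have hlength : closedLength ![0, d] = 2 * W := by
    simp [closedLength, hd, two_mul]
  rw [← hlength]
  refine xi_le_closedLength le_rfl fun hfit => ?_
  obtain ⟨t, ht⟩ := fitsInterior_iff.1 hfit
  have hlt := h.inner_sub_lt_of_mem_interior hn (ht 1) (interior_subset (ht 0))
  refine hlt.ne ?_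
  calc ⟪n, d - t - (0 - t)⟫ = W / ‖n‖ * ‖n‖ ^ 2 := by
        rw [sub_sub_sub_cancel_right, sub_zero, real_inner_smul_right, real_inner_self_eq_norm_sq]
    _ = W * ‖n‖ := by field_simp

theorem exists_hasWidthLE_of_not_fitsInterior [CompleteSpace E] (hK : Convex ℝ K)
    (hint : (interior K).Nonempty) {q : Fin 3 → E} (hq : ¬ FitsInterior K q) :
    ∃ n ≠ 0, HasWidthLE K n (closedLength q / √3) := by
  obtain ⟨u, hu₀, husum, hu⟩ := exists_normals_of_not_fitsInterior hK hint hq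
  obtain ⟨i₀, hi₀⟩ := Finite.exists_max fun i => ‖u i‖
  refine ⟨u i₀, fun h => hu₀ (funext fun i => ?_), fun x hx y hy => ?_⟩
  · simpa [h] using hi₀ i
  calc ⟪u i₀, x - y⟫ = ∑ i, ⟪u i, y + (Pi.single i₀ (x - y) : Fin 3 → E) i⟫ := by
        simp only [inner_add_right, Finset.sum_add_distrib, ← sum_inner, husum, inner_zero_left,
          zero_add]
        rw [Finset.sum_eq_single i₀ (by simp +contextual) (by simp), Pi.single_eq_same]
    _ ≤ ∑ i, ⟪u i, q i⟫ := hu _ fun i => by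
        rcases eq_or_ne i i₀ with rfl | hi <;> simp [*]
    _ ≤ ‖u i₀‖ / √3 * closedLength q := sum_inner_le_mul_closedLength husum hi₀
    _ = closedLength q / √3 * ‖u i₀‖ := by ring

end Width

section DifferenceBody

theorem xi_sub_self_le {E : Type*} [NormedAddCommGroup E] [InnerProductSpace ℝ E]
    (hE : Module.finrank ℝ E = 2) {K : Set E} (hK : Convex ℝ K) (hint : (interior K).Nonempty)
    (hne : (nonFittingLengths K).Nonempty) : xi (K - K) ≤ 4 / √3 * xi K := by
  have : FiniteDimensional ℝ E := .of_finrank_pos (by omega)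
  have hpos : (0 : ℝ) < 4 / √3 := by positivity
  rw [← div_le_iff₀' hpos]
  refine le_xi hne fun m q _ hq => (div_le_iff₀' hpos).2 ?_
  obtain ⟨φ, hφ, hqφ⟩ : ∃ φ : Fin 3 → Fin m, Monotone φ ∧ ¬ FitsInterior K (q ∘ φ) :=
    exists_monotone_not_fitsInterior_comp hE.le hK hq
  obtain ⟨n, hn, hwidth⟩ := exists_hasWidthLE_of_not_fitsInterior hK hint hqφ
  have hW : 0 ≤ closedLength (q ∘ φ) / √3 :=
    div_nonneg (Finset.sum_nonneg fun _ _ => norm_nonneg _) (Real.sqrt_nonneg 3)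
  calc xi (K - K) ≤ 2 * (2 * (closedLength (q ∘ φ) / √3)) :=
        xi_le_two_mul_of_hasWidthLE hwidth.sub_self hn (by positivity)
    _ = 4 / √3 * closedLength (q ∘ φ) := by ring
    _ ≤ 4 / √3 * closedLength q := by gcongr; exact closedLength_comp_le_of_monotone q hφ

end DifferenceBody

section Simplices

variable {E : Type*} [NormedAddCommGroup E] [NormedSpace ℝ E]

theorem not_fitsInterior_convexHull_of_coord_nonpos [FiniteDimensional ℝ E] {m : ℕ}
    (b : AffineBasis (Fin m) ℝ E) {q : Fin m → E} (hq : ∀ i, b.coord i (q i) ≤ 0) :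
    ¬ FitsInterior (convexHull ℝ (Set.range b)) q := by
  rw [fitsInterior_iff, b.interior_convexHull]
  rintro ⟨t, ht⟩
  have hcoord (i : Fin m) : b.coord i t < b.coord i 0 := by
    have hsub : (b.coord i).linear t = b.coord i (q i) - b.coord i (q i - t) := by
      simpa only [vsub_eq_sub, sub_sub_cancel] using (b.coord i).linearMap_vsub (q i) (q i - t)
    have hzero : (b.coord i).linear t = b.coord i t - b.coord i 0 := by
      simpa only [vsub_eq_sub, sub_zero] using (b.coord i).linearMap_vsub t 0
    linarith [hq i, ht i i]
  have hsum := Finset.sum_lt_sum_of_nonempty (Finset.univ_nonempty_iff.2 b.nonempty)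
    fun i _ => hcoord i
  simp [b.sum_coord_apply_eq_one] at hsum

theorem xi_convexHull_le_closedLength_div_two (b : AffineBasis (Fin 3) ℝ E) :
    xi (convexHull ℝ (Set.range b)) ≤ closedLength b / 2 := by
  have := b.finiteDimensional
  let q (i : Fin 3) : E := midpoint ℝ (b (i + 1)) (b (i + 2))
  have hlength : closedLength q = closedLength b / 2 := by
    simp only [closedLength, Finset.sum_div, finRotate_apply]
    refine Finset.sum_congr rfl fun i _ => ?_
    have hsub : q (i + 1) - q i = (-2⁻¹ : ℝ) • (b (i + 1) - b i) := by
      have h₁ : i + 1 + 1 = i + 2 := by decide +revert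
      have h₂ : i + 1 + 2 = i := by decide +revert
      simp only [q, h₁, h₂, midpoint_eq_smul_add, invOf_eq_inv]
      module
    rw [hsub, norm_smul, norm_neg, norm_inv, Real.norm_two, inv_mul_eq_div]
  rw [← hlength]
  refine xi_le_closedLength (by norm_num)
    (not_fitsInterior_convexHull_of_coord_nonpos b fun i => ?_)
  have h₁ : i ≠ i + 1 := by decide +revert
  have h₂ : i ≠ i + 2 := by decide +revert
  rw [AffineMap.map_midpoint, b.coord_apply_ne h₁, b.coord_apply_ne h₂, midpoint_self]

theorem sum_smul_mem_convexHull_sub_self {ι : Type*} [Fintype ι] [Nonempty ι]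
    (p : ι → E) {w : ι → ℝ} (hw : ∑ i, w i = 0) (hw' : ∑ i, |w i| ≤ 2) :
    ∑ i, w i • p i ∈ convexHull ℝ (Set.range p) - convexHull ℝ (Set.range p) := by
  let c : ℝ := (1 - ∑ i, (w i)⁺) / Fintype.card ι
  have hpos_eq_neg : ∑ i, (w i)⁺ = ∑ i, (w i)⁻ := by
    simp only [← sub_eq_zero, ← Finset.sum_sub_distrib, posPart_sub_negPart, hw]
  have habs : ∑ i, |w i| = ∑ i, (w i)⁺ + ∑ i, (w i)⁻ := by
    simp only [← Finset.sum_add_distrib, posPart_add_negPart]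
  have hc : 0 ≤ c := div_nonneg (by linarith) (Nat.cast_nonneg _)
  have hsum : ∑ i, ((w i)⁺ + c) = 1 := by
    simp [Finset.sum_add_distrib, c, mul_div_cancel₀]
  have hsum' : ∑ i, ((w i)⁻ + c) = 1 := by
    rw [← hsum, Finset.sum_add_distrib, Finset.sum_add_distrib, hpos_eq_neg]
  have hmem (i : ι) : p i ∈ convexHull ℝ (Set.range p) := subset_convexHull ℝ _ ⟨i, rfl⟩
  refine ⟨∑ i, ((w i)⁺ + c) • p i, (convex_convexHull ℝ _).sum_mem
    (fun i _ => add_nonneg (posPart_nonneg _) hc) hsum fun i _ => hmem i,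
    ∑ i, ((w i)⁻ + c) • p i, (convex_convexHull ℝ _).sum_mem
    (fun i _ => add_nonneg (negPart_nonneg _) hc) hsum' fun i _ => hmem i, ?_⟩
  simp only [← Finset.sum_sub_distrib, ← sub_smul, add_sub_add_right_eq_sub, posPart_sub_negPart]

theorem sum_abs_le_two_of_sum_sq_le {w : Fin 3 → ℝ} (hw : ∑ i, w i = 0)
    (hsq : ∑ i, w i ^ 2 ≤ 3 / 2) : ∑ i, |w i| ≤ 2 := by
  have hpair {x y z : ℝ} (hsum : x + y + z = 0) (hsq : x ^ 2 + y ^ 2 + z ^ 2 ≤ 3 / 2)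
      (hxy : 0 ≤ x * y) : |x| + |y| + |z| ≤ 2 := by
    obtain rfl : z = -(x + y) := by linarith
    have : |x + y| ≤ 1 := abs_le_one_iff_mul_self_le_one.2 (by nlinarith [sq_nonneg (x - y)])
    have := (abs_add_eq_add_abs_iff x y).2 (mul_nonneg_iff.1 hxy)
    rw [abs_neg]
    linarith
  rw [Fin.sum_univ_three] at *
  rcases mul_nonneg_of_three (w 0) (w 1) (w 2) with h | h | h
  · exact hpair hw hsq h
  · linarith [hpair (z := w 0) (by linarith) (by linarith) h]
  · linarith [hpair (z := w 1) (by linarith) (by linarith) h]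

end Simplices

section EquilateralTriangles

variable {E : Type*} [NormedAddCommGroup E] [InnerProductSpace ℝ E] {ι : Type*} {p : ι → E} {a : ℝ}

theorem norm_sum_smul_sq_of_pairwise_dist_eq (hp : Pairwise fun i j => dist (p i) (p j) = a)
    (s : Finset ι) {w : ι → ℝ} (hw : ∑ i ∈ s, w i = 0) :
    ‖∑ i ∈ s, w i • p i‖ ^ 2 = a ^ 2 / 2 * ∑ i ∈ s, w i ^ 2 := by
  classical
  have hterm (i j : ι) : w i * w j * ‖p i - p j‖ ^ 2 =
      (w i * w j - if i = j then w i ^ 2 else 0) * a ^ 2 := by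
    split_ifs with h
    · subst h
      simp [sq]
    · rw [← dist_eq_norm, hp h, sub_zero]
  simp only [norm_sum_smul_sq, hw, hterm, ← Finset.sum_mul, sum_sum_mul_sub_ite_eq]
  ring

theorem affineIndependent_of_pairwise_dist_eq (hp : Pairwise fun i j => dist (p i) (p j) = a)
    (ha : a ≠ 0) : AffineIndependent ℝ p := by
  refine affineIndependent_iff.2 fun s w hw hsum i hi => ?_
  have hsq := norm_sum_smul_sq_of_pairwise_dist_eq hp s hw
  rw [hsum, norm_zero, zero_pow two_ne_zero, eq_comm, mul_eq_zero_iff_left (by positivity),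
    Finset.sum_eq_zero_iff_of_nonneg fun i _ => sq_nonneg (w i)] at hsq
  exact pow_eq_zero_iff two_ne_zero |>.1 (hsq i hi)

theorem exists_equilateral_triangle (hE : 2 ≤ Module.finrank ℝ E) :
    ∃ s : Affine.Simplex ℝ E 2, s.Equilateral := by
  have : FiniteDimensional ℝ E := .of_finrank_pos (by omega)
  let v := stdOrthonormalBasis ℝ E
  let e : E := v ⟨0, by omega⟩
  let f : E := v ⟨1, by omega⟩
  have he : ‖e‖ = 1 := v.norm_eq_one _
  have hf : ‖f‖ = 1 := v.norm_eq_one _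
  have hinner : inner ℝ e f = 0 := v.orthonormal.2 (by simp)
  have hbase : dist (-e) e = 2 := by
    rw [dist_eq_norm, ← neg_add', norm_neg, ← two_smul ℝ, norm_smul, he]
    norm_num
  have hside {x : E} (hx : ‖x‖ = 1) (hxv : inner ℝ x f = 0) : dist x (√3 • f) = 2 := by
    rw [dist_eq_norm, ← sq_eq_sq₀ (norm_nonneg _) zero_le_two, norm_sub_sq_real,
      real_inner_smul_right, hxv, hx, norm_smul, hf, Real.norm_of_nonneg (by positivity),
      mul_one, Real.sq_sqrt (by norm_num)]
    norm_num
  have hleft : dist (-e) (√3 • f) = 2 :=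
    hside (by rw [norm_neg, he]) (by rw [inner_neg_left, hinner, neg_zero])
  have hright : dist e (√3 • f) = 2 := hside he hinner
  have hp : Pairwise fun i j => dist (![-e, e, √3 • f] i) (![-e, e, √3 • f] j) = 2 := by
    intro i j hij
    fin_cases i <;> fin_cases j <;>
      first
      | exact absurd rfl hij
      | exact hbase
      | exact hleft
      | exact hright
      | exact (dist_comm _ _).trans hbase
      | exact (dist_comm _ _).trans hleft
      | exact (dist_comm _ _).trans hright
  exact ⟨⟨_, affineIndependent_of_pairwise_dist_eq hp two_ne_zero⟩, 2, fun i j hij => hp hij⟩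

theorem ball_subset_convexHull_sub_self {b : AffineBasis (Fin 3) ℝ E}
    (hb : Pairwise fun i j => dist (b i) (b j) = a) :
    Metric.ball 0 (√3 / 2 * a) ⊆ convexHull ℝ (Set.range b) - convexHull ℝ (Set.range b) := by
  intro z hz
  have ha : 0 < a := by
    rw [mem_ball_zero_iff] at hz
    nlinarith [norm_nonneg z, Real.sqrt_nonneg 3]
  let w (i : Fin 3) : ℝ := b.coord i z - b.coord i 0
  have hw : ∑ i, w i = 0 := by
    simp only [w, Finset.sum_sub_distrib, b.sum_coord_apply_eq_one, sub_self]
  have hz' : ∑ i, w i • b i = z := by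
    simp only [w, sub_smul, Finset.sum_sub_distrib, b.linear_combination_coord_eq_self, sub_zero]
  have hsq : ∑ i, w i ^ 2 ≤ 3 / 2 := by
    have := norm_sum_smul_sq_of_pairwise_dist_eq hb Finset.univ hw
    have hlt : ‖z‖ ^ 2 < (√3 / 2 * a) ^ 2 :=
      pow_lt_pow_left₀ (mem_ball_zero_iff.1 hz) (norm_nonneg z) two_ne_zero
    rw [mul_pow, div_pow, Real.sq_sqrt zero_le_three, ← hz', this] at hlt
    nlinarith [sq_pos_of_pos ha]
  rw [← hz']
  exact sum_smul_mem_convexHull_sub_self b hw (sum_abs_le_two_of_sum_sq_le hw hsq)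

theorem xi_sub_self_eq_of_pairwise_dist_eq {b : AffineBasis (Fin 3) ℝ E}
    (hb : Pairwise fun i j => dist (b i) (b j) = a) :
    xi (convexHull ℝ (Set.range b) - convexHull ℝ (Set.range b)) =
      4 / √3 * xi (convexHull ℝ (Set.range b)) := by
  have hE : Module.finrank ℝ E = 2 := by
    simpa using b.card_eq_finrank_add_one.symm
  have : Nontrivial E := Module.nontrivial_of_finrank_pos (R := ℝ) (by omega)
  have hbounded : Bornology.IsBounded (convexHull ℝ (Set.range b)) :=
    isBounded_convexHull.2 (Set.finite_range b).isBounded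
  have hlength : closedLength b = 3 * a := by
    have hside (i : Fin 3) : ‖b (finRotate 3 i) - b i‖ = a := by
      rw [← dist_eq_norm]
      exact hb (by decide +revert)
    simp only [closedLength, hside, Finset.sum_const, Finset.card_univ, Fintype.card_fin,
      nsmul_eq_mul, Nat.cast_ofNat]
  refine le_antisymm (xi_sub_self_le hE (convex_convexHull ℝ _)
    ⟨_, b.centroid_mem_interior_convexHull⟩ (nonFittingLengths_nonempty hbounded)) ?_
  calc 4 / √3 * xi (convexHull ℝ (Set.range b)) ≤ 4 / √3 * (3 * a / 2) := by
        gcongr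
        exact hlength ▸ xi_convexHull_le_closedLength_div_two b
    _ = 4 * (√3 / 2 * a) := by
        field_simp
        rw [Real.sq_sqrt zero_le_three]
    _ ≤ xi (convexHull ℝ (Set.range b) - convexHull ℝ (Set.range b)) :=
        four_mul_le_xi_of_ball_subset (nonFittingLengths_nonempty (hbounded.sub hbounded))
          (ball_subset_convexHull_sub_self hb)

end EquilateralTriangles

section MainTheorem

variable {E : Type*} [NormedAddCommGroup E] [InnerProductSpace ℝ E]

theorem xi_sub_self_eq_of_equilateral (hE : Module.finrank ℝ E = 2) {s : Affine.Simplex ℝ E 2}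
    (hs : s.Equilateral) :
    xi (convexHull ℝ (Set.range s.points) - convexHull ℝ (Set.range s.points)) =
      4 / √3 * xi (convexHull ℝ (Set.range s.points)) := by
  have : FiniteDimensional ℝ E := .of_finrank_pos (by omega)
  obtain ⟨a, ha⟩ := hs
  exact xi_sub_self_eq_of_pairwise_dist_eq (b := ⟨s.points, s.independent, s.span_eq_top hE⟩) ha

theorem le_of_forall_xi_sub_self_le (hE : Module.finrank ℝ E = 2) {c : ℝ}
    (hc : ∀ K : ConvexBody E, (interior (K : Set E)).Nonempty →
      xi ((K : Set E) - (K : Set E)) ≤ c * xi (K : Set E)) : 4 / √3 ≤ c := by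
  have : FiniteDimensional ℝ E := .of_finrank_pos (by omega)
  have : Nontrivial E := Module.nontrivial_of_finrank_pos (R := ℝ) (by omega)
  obtain ⟨s, hs⟩ := exists_equilateral_triangle hE.ge
  let K : ConvexBody E := ⟨convexHull ℝ (Set.range s.points), convex_convexHull ℝ _,
    (Set.finite_range _).isCompact_convexHull (𝕜 := ℝ), (Set.range_nonempty _).convexHull⟩
  have hint : (interior (K : Set E)).Nonempty :=
    interior_convexHull_nonempty_iff_affineSpan_eq_top.2 (s.span_eq_top hE)
  refine le_of_mul_le_mul_right ?_ (xi_pos (nonFittingLengths_nonempty K.isBounded) hint)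
  exact (xi_sub_self_eq_of_equilateral hE hs).ge.trans (hc K hint)

theorem mainTheorem3_general (hE : Module.finrank ℝ E = 2) :
    (∀ K : Set E, Convex ℝ K → (interior K).Nonempty → (nonFittingLengths K).Nonempty →
      xi (K - K) ≤ 4 / √3 * xi K) ∧
    (∀ c : ℝ,
      (∀ K : ConvexBody E, (interior (K : Set E)).Nonempty →
        xi ((K : Set E) - (K : Set E)) ≤ c * xi (K : Set E)) →
      4 / √3 ≤ c) ∧
    (∀ s : Affine.Simplex ℝ E 2, s.Equilateral →
      xi (convexHull ℝ (Set.range s.points) - convexHull ℝ (Set.range s.points)) =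
        4 / √3 * xi (convexHull ℝ (Set.range s.points))) :=
  ⟨fun _ hK hint hne => xi_sub_self_le hE hK hint hne, fun _ => le_of_forall_xi_sub_self_le hE,
    fun _ => xi_sub_self_eq_of_equilateral hE⟩

end MainTheorem

theorem mainTheorem3 :
    (∀ K : ConvexBody Plane, (interior (K : Set Plane)).Nonempty →
      xi ((K : Set Plane) - (K : Set Plane)) ≤ 4 / Real.sqrt 3 * xi (K : Set Plane)) ∧
    (∀ c : ℝ,
      (∀ K : ConvexBody Plane, (interior (K : Set Plane)).Nonempty →
        xi ((K : Set Plane) - (K : Set Plane)) ≤ c * xi (K : Set Plane)) →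
      4 / Real.sqrt 3 ≤ c) ∧
    (∀ s : Affine.Simplex ℝ Plane 2, s.Equilateral →
      xi (convexHull ℝ (Set.range s.points) - convexHull ℝ (Set.range s.points)) =
        4 / Real.sqrt 3 * xi (convexHull ℝ (Set.range s.points))) :=
  (mainTheorem3_general finrank_euclideanSpace_fin).imp_left fun hle K hint =>
    hle K K.convex hint (nonFittingLengths_nonempty K.isBounded)
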